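/- Let $\{\alpha_n\}_{n\ge 0}$ be a sequence of complex numbers and $N\ge 1$ an integer such that $|\alpha_n|\neq 1$ for $0\le n\le N-1$ and $|\alpha_n|<1$ for all $n\ge N$. Put $\omega_{N-1}=\prod_{j=0}^{N-1}(1-|\alpha_j|^2)$ and $\epsilon_{N-1}=\operatorname{sign}\omega_{N-1}$. Let $\mathbb D$ be the open unit disk and $\mathbb T$ the unit circle. A Schur function is an analytic function $\mathbb D\to\overline{\mathbb D}$. Define the Wall polynomials by $A_0=\alpha_0$, $B_0=1$ and $$A_{n+1}=A_n+\alpha_{n+1}zB_n^*,\qquad B_{n+1}=B_n+\alpha_{n+1}zA_n^*,$$ where $A_n^*(z)=z^n\overline{A_n(1/\bar z)}$ and $B_n^*(z)=z^n\overline{B_n(1/\bar z)}$. Then there is a Schur function $f_N$ corresponding to $\{\alpha_n\}_{n\ge N}$, that is, one that begins a sequence $f_N,f_{N+1},f_{N+2},\dots$ of Schur functions with $$f_n(z)=\frac{\alpha_n+zf_{n+1}(z)}{1+\overline{\alpha_n}\,zf_{n+1}(z)}\qquad(z\in\mathbb D,\ n\ge N).$$ For every such $f_N$, put $$f(z)=\frac{A_{N-1}(z)+zB_{N-1}^*(z)f_N(z)}{B_{N-1}(z)+zA_{N-1}^*(z)f_N(z)},\qquad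 F(z)=\frac{1+zf(z)}{1-zf(z)}.$$ Then $\epsilon_{N-1}F$ is a pseudo-Carathéodory function: it is a ratio of two bounded analytic functions in $\mathbb D$ (with denominator not identically zero), and for almost every $\zeta\in\mathbb T$ its nontangential limit at $\zeta$ exists and has nonnegative real part. -/

import Mathlib

open Polynomial Filter Topology MeasureTheory

/-- `g` is bounded and analytic in the open unit disk (values outside the disk are irrelevant). -/
def IsBoundedAnalytic (g : ℂ → ℂ) : Prop :=
  DifferentiableOn ℂ g (Metric.ball 0 1) ∧ ∃ C : ℝ, ∀ z ∈ Metric.ball (0 : ℂ) 1, ‖g z‖ ≤ C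

/-- A Schur function: analytic in the open unit disk with values in the closed unit disk. -/
def IsSchur (f : ℂ → ℂ) : Prop :=
  DifferentiableOn ℂ f (Metric.ball 0 1) ∧ ∀ z ∈ Metric.ball (0 : ℂ) 1, ‖f z‖ ≤ 1

/-- `f` is the Schur function corresponding to the sequence `β`: it is the first term of a sequence
of Schur functions `s 0 = f, s 1, s 2, …` related by the Schur algorithm with parameters `β`. -/
def IsSchurFunctionOf (β : ℕ → ℂ) (f : ℂ → ℂ) : Prop :=
  ∃ s : ℕ → ℂ → ℂ, s 0 = f ∧ (∀ n, IsSchur (s n)) ∧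
    ∀ n, ∀ z ∈ Metric.ball (0 : ℂ) 1,
      s n z = (β n + z * s (n + 1) z) / (1 + (starRingEnd ℂ) (β n) * z * s (n + 1) z)

/-- The reversed polynomial `p^*(z) = z ^ n * conj (p (1 / conj z))` of a polynomial `p` of degree
at most `n`: its `k`-th coefficient is the conjugate of the `(n - k)`-th coefficient of `p`. -/
noncomputable def revPoly (n : ℕ) (p : ℂ[X]) : ℂ[X] :=
  (p.map (starRingEnd ℂ)).reflect n

/-- The pair `(A_n, B_n)` of Wall polynomials of the sequence `α`, the coefficients that arise when
the first `n + 1` steps of the Schur algorithm are composed. The reversals of `A_n` and `B_n` are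
taken with respect to the degree `n`. -/
noncomputable def wall (α : ℕ → ℂ) : ℕ → ℂ[X] × ℂ[X]
  | 0 => (C (α 0), 1)
  | n + 1 =>
      ((wall α n).1 + C (α (n + 1)) * X * revPoly n (wall α n).2,
       (wall α n).2 + C (α (n + 1)) * X * revPoly n (wall α n).1)

/-- The Wall polynomial `A_n`. -/
noncomputable def wallA (α : ℕ → ℂ) (n : ℕ) : ℂ[X] := (wall α n).1

/-- The Wall polynomial `B_n`. -/
noncomputable def wallB (α : ℕ → ℂ) (n : ℕ) : ℂ[X] := (wall α n).2

/-- `ω_n = ∏_{j=0}^{n} (1 - |α_j|²)`. -/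
noncomputable def omega (α : ℕ → ℂ) (n : ℕ) : ℝ :=
  ∏ j ∈ Finset.range (n + 1), (1 - ‖α j‖ ^ 2)

/-- The function `f = (A_n + z B_n^* φ) / (B_n + z A_n^* φ)` obtained from `φ` by the first `n + 1`
steps of the Schur algorithm. -/
noncomputable def schurCompose (α : ℕ → ℂ) (n : ℕ) (φ : ℂ → ℂ) (z : ℂ) : ℂ :=
  ((wallA α n).eval z + z * (revPoly n (wallB α n)).eval z * φ z) /
    ((wallB α n).eval z + z * (revPoly n (wallA α n)).eval z * φ z)

/-- The analogue `F = (1 + z f) / (1 - z f)` of the Carathéodory function. -/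
noncomputable def caratheodoryOf (f : ℂ → ℂ) (z : ℂ) : ℂ :=
  (1 + z * f z) / (1 - z * f z)

/-- `F` has the nontangential limit `w` at the point `ζ` of the unit circle: `F (ζ z)` tends to `w`
as `z` tends to `1` inside any Stolz region `{z | ‖z‖ < 1 ∧ ‖1 - z‖ < M * (1 - ‖z‖)}`. -/
def HasNontangentialLimit (F : ℂ → ℂ) (ζ w : ℂ) : Prop :=
  ∀ M : ℝ, Tendsto (fun z => F (ζ * z)) (𝓝[Complex.stolzSet M] 1) (𝓝 w)

/-- Pseudo-Carathéodory functions: `F` is the ratio `g / h` of two bounded analytic functions in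
the unit disk, with `h` not identically zero, and for almost every point of the unit circle the
boundary value of `F` exists and has nonnegative real part. As `F` is a meromorphic function, its
values at the zeros of `h` are left unspecified; they do not influence the boundary values outside
a null set. -/
def IsPseudoCaratheodory (F : ℂ → ℂ) : Prop :=
  (∃ g h : ℂ → ℂ, IsBoundedAnalytic g ∧ IsBoundedAnalytic h ∧
    (∃ z ∈ Metric.ball (0 : ℂ) 1, h z ≠ 0) ∧
    ∀ z ∈ Metric.ball (0 : ℂ) 1, h z ≠ 0 → F z = g z / h z) ∧
  ∀ᵐ θ : ℝ ∂(volume.restrict (Set.Ioc (0 : ℝ) (2 * Real.pi))),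
    ∃ w : ℂ, HasNontangentialLimit F (Complex.exp ((θ : ℂ) * Complex.I)) w ∧ 0 ≤ w.re

/-! Existence of `f_N`: cutting the Schur algorithm off after `k` steps gives Schur functions whose
consecutive differences vanish to order `k` at `0`. The Schwarz lemma bounds them by `2‖z‖ ^ k`, so
they converge locally uniformly and the limits inherit the recursion.

Sign of the real part: on the circle `|B|² - |A|² = ω`, and composing with a boundary value `w` of
the Schur function turns this into `|Q|² - |P|² = ω (1 - |w|²)`, where `f = P / Q`. As `|w| ≤ 1`, `1
- |f|²` is zero or has the sign of `ω`, and `Re F = (1 - |f|²) / |1 - ζ f|²`.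

What remains is that boundary values exist almost everywhere. For the Schur function this is Fatou's
theorem: a primitive of a bounded analytic function is Lipschitz, hence differentiable along the
circle almost everywhere, and a Phragmén–Lindelöf argument with Cauchy's estimate carries this
derivative into Stolz regions. The quotients cause no trouble because `Q` and `Q - z P` equal `1` at
`0`, so by Jensen's inequality and Fatou's lemma their boundary values are nonzero almost
everywhere. -/

/-! ### Existence of the Schur function with given parameters -/

/-- One step `(b + z g) / (1 + conj b z g)` of the inverse Schur algorithm. -/
noncomputable def schurStep (b : ℂ) (g : ℂ → ℂ) (z : ℂ) : ℂ :=
  (b + z * g z) / (1 + (starRingEnd ℂ) b * z * g z)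

theorem norm_mul_le_one_of_isSchur {g : ℂ → ℂ} (hg : IsSchur g) {z : ℂ}
    (hz : z ∈ Metric.ball (0 : ℂ) 1) : ‖z * g z‖ ≤ 1 := by
  have h1 : ‖z‖ < 1 := by simpa using hz
  have h2 := hg.2 z hz
  rw [norm_mul]
  nlinarith [norm_nonneg z, norm_nonneg (g z)]

theorem le_norm_schurStep_denom (b : ℂ) {g : ℂ → ℂ} (hg : IsSchur g) {z : ℂ}
    (hz : z ∈ Metric.ball (0 : ℂ) 1) : 1 - ‖b‖ ≤ ‖1 + (starRingEnd ℂ) b * z * g z‖ := by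
  have h1 := norm_mul_le_one_of_isSchur hg hz
  have h2 : ‖(starRingEnd ℂ) b * z * g z‖ ≤ ‖b‖ := by
    rw [mul_assoc, norm_mul, RCLike.norm_conj]
    nlinarith [norm_nonneg b]
  have h3 := norm_sub_norm_le (1 : ℂ) (-((starRingEnd ℂ) b * z * g z))
  rw [sub_neg_eq_add, norm_neg, norm_one] at h3
  linarith

theorem schurStep_denom_ne_zero {b : ℂ} (hb : ‖b‖ < 1) {g : ℂ → ℂ} (hg : IsSchur g) {z : ℂ}
    (hz : z ∈ Metric.ball (0 : ℂ) 1) : 1 + (starRingEnd ℂ) b * z * g z ≠ 0 := by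
  have := le_norm_schurStep_denom b hg hz
  rw [← norm_pos_iff]
  linarith

theorem normSq_one_add_sub_normSq_add (b w : ℂ) :
    ‖1 + (starRingEnd ℂ) b * w‖ ^ 2 - ‖b + w‖ ^ 2 = (1 - ‖b‖ ^ 2) * (1 - ‖w‖ ^ 2) := by
  simp only [Complex.sq_norm, Complex.normSq_apply, Complex.add_re, Complex.add_im, Complex.mul_re,
    Complex.mul_im, Complex.conj_re, Complex.conj_im, Complex.one_re, Complex.one_im]
  ring

theorem IsSchur.schurStep {b : ℂ} (hb : ‖b‖ < 1) {g : ℂ → ℂ} (hg : IsSchur g) :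
    IsSchur (schurStep b g) := by
  refine ⟨?_, fun z hz => ?_⟩
  · have := hg.1
    refine DifferentiableOn.div ?_ ?_ fun z hz => schurStep_denom_ne_zero hb hg hz
    · fun_prop
    · fun_prop
  · have h0 := schurStep_denom_ne_zero hb hg hz
    have h1 := norm_mul_le_one_of_isSchur hg hz
    have h2 := normSq_one_add_sub_normSq_add b (z * g z)
    rw [← mul_assoc] at h2
    rw [_root_.schurStep, norm_div, div_le_one (norm_pos_iff.2 h0)]
    refine le_of_sq_le_sq ?_ (norm_nonneg _)
    have h3 : 0 ≤ (1 - ‖b‖ ^ 2) * (1 - ‖z * g z‖ ^ 2) := by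
      apply mul_nonneg
      · nlinarith [norm_nonneg b]
      · nlinarith [norm_nonneg (z * g z)]
    linarith

/-- The `k`-th approximant of the Schur function with parameters `β n, β (n + 1), …`. -/
noncomputable def schurApprox (β : ℕ → ℂ) : ℕ → ℕ → ℂ → ℂ
  | 0, _ => fun _ => 0
  | k + 1, n => schurStep (β n) (schurApprox β k (n + 1))

theorem isSchur_schurApprox {β : ℕ → ℂ} (hβ : ∀ n, ‖β n‖ < 1) (k n : ℕ) :
    IsSchur (schurApprox β k n) := by
  induction k generalizing n with
  | zero => exact ⟨differentiableOn_const 0, fun z _ => by simp [schurApprox]⟩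
  | succ k ih => exact (ih (n + 1)).schurStep (hβ n)

/-- The difference of two steps has the factor `z (g - h)`, so it vanishes to one order more. The
direct estimate has a constant that blows up as `‖b‖ → 1`; it serves only to give the order of
vanishing, and the Schwarz lemma restores the constant `2`, which allows iteration over all
parameters. -/
theorem norm_schurStep_sub_le {b : ℂ} (hb : ‖b‖ < 1) {g h : ℂ → ℂ} (hg : IsSchur g)
    (hh : IsSchur h) {k : ℕ}
    (hgh : ∀ z ∈ Metric.ball (0 : ℂ) 1, ‖g z - h z‖ ≤ 2 * ‖z‖ ^ k) {z : ℂ}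
    (hz : z ∈ Metric.ball (0 : ℂ) 1) :
    ‖schurStep b g z - schurStep b h z‖ ≤ 2 * ‖z‖ ^ (k + 1) := by
  set f : ℂ → ℂ := fun z => schurStep b g z - schurStep b h z with hf
  have hf0 : f 0 = 0 := by simp [hf, schurStep]
  have hg' := hg.schurStep hb
  have hh' := hh.schurStep hb
  have hmaps : Set.MapsTo f (Metric.ball 0 1) (Metric.closedBall (f 0) 2) := by
    intro w hw
    rw [hf0, mem_closedBall_zero_iff]
    have := norm_sub_le (schurStep b g w) (schurStep b h w)
    linarith [hg'.2 w hw, hh'.2 w hw]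
  have hbound : ∀ w ∈ Metric.ball (0 : ℂ) 1,
      ‖f w‖ ≤ 4 / (1 - ‖b‖) ^ 2 * ‖w‖ ^ (k + 1) := by
    intro w hw
    have e : f w = w * (g w - h w) * (1 - (starRingEnd ℂ) b * b) /
        ((1 + (starRingEnd ℂ) b * w * g w) * (1 + (starRingEnd ℂ) b * w * h w)) := by
      have h1 := schurStep_denom_ne_zero hb hg hw
      have h2 := schurStep_denom_ne_zero hb hh hw
      simp only [hf, schurStep]
      rw [div_sub_div _ _ h1 h2]
      congr 1
      ring
    have hb' : ‖1 - (starRingEnd ℂ) b * b‖ ≤ 2 := by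
      refine (norm_sub_le _ _).trans ?_
      rw [norm_mul, RCLike.norm_conj, norm_one]
      nlinarith [norm_nonneg b]
    have h1 := le_norm_schurStep_denom b hg hw
    have h2 := le_norm_schurStep_denom b hh hw
    have h3 := hgh w hw
    have hb1 : 0 < 1 - ‖b‖ := by linarith
    rw [e, norm_div, norm_mul, norm_mul, norm_mul]
    calc ‖w‖ * ‖g w - h w‖ * ‖1 - (starRingEnd ℂ) b * b‖ /
          (‖1 + (starRingEnd ℂ) b * w * g w‖ * ‖1 + (starRingEnd ℂ) b * w * h w‖)
        ≤ ‖w‖ * (2 * ‖w‖ ^ k) * 2 / ((1 - ‖b‖) * (1 - ‖b‖)) := by gcongr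
      _ = _ := by ring
  have hO : (f · - f 0) =o[𝓝 0] (fun w : ℂ => ‖w - 0‖ ^ k) := by
    simp only [hf0, sub_zero]
    have h1 : f =O[𝓝 0] (fun w : ℂ => ‖w‖ ^ (k + 1)) := by
      refine Asymptotics.IsBigO.of_bound (4 / (1 - ‖b‖) ^ 2) ?_
      filter_upwards [Metric.ball_mem_nhds (0 : ℂ) one_pos] with w hw
      simpa using hbound w hw
    refine h1.trans_isLittleO ?_
    have h2 : (fun w : ℂ => ‖w‖) =o[𝓝 0] (fun _ => (1 : ℝ)) := by
      rw [Asymptotics.isLittleO_one_iff]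
      exact tendsto_norm_zero
    simpa [pow_succ] using (Asymptotics.isBigO_refl (fun w : ℂ => ‖w‖ ^ k) (𝓝 0)).mul_isLittleO h2
  have hfd : DifferentiableOn ℂ f (Metric.ball 0 1) := hg'.1.sub hh'.1
  have := Complex.dist_le_mul_div_pow_of_mapsTo_ball_of_isLittleO hfd hmaps hO hz
  rw [hf0, dist_zero_right, dist_zero_right, div_one] at this
  exact this

theorem norm_schurApprox_succ_sub_le {β : ℕ → ℂ} (hβ : ∀ n, ‖β n‖ < 1) (k n : ℕ) :
    ∀ z ∈ Metric.ball (0 : ℂ) 1,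
      ‖schurApprox β (k + 1) n z - schurApprox β k n z‖ ≤ 2 * ‖z‖ ^ k := by
  induction k generalizing n with
  | zero =>
    intro z hz
    have := (isSchur_schurApprox hβ 1 n).2 z hz
    simp only [schurApprox] at this ⊢
    simp only [sub_zero, pow_zero]
    linarith
  | succ k ih =>
    intro z hz
    exact norm_schurStep_sub_le (hβ n) (isSchur_schurApprox hβ (k + 1) (n + 1))
      (isSchur_schurApprox hβ k (n + 1)) (ih (n + 1)) hz

theorem exists_isSchur_tendsto_schurApprox {β : ℕ → ℂ} (hβ : ∀ n, ‖β n‖ < 1) (n : ℕ) :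
    ∃ s : ℂ → ℂ, IsSchur s ∧ ∀ z ∈ Metric.ball (0 : ℂ) 1,
      Tendsto (fun k => schurApprox β k n z) atTop (𝓝 (s z)) := by
  set F : ℕ → ℂ → ℂ := fun k z => schurApprox β (k + 1) n z - schurApprox β k n z with hF
  have hsum : ∀ r : ℝ, 0 ≤ r → r < 1 → Summable fun k : ℕ => 2 * r ^ k := fun r h0 h1 =>
    (summable_geometric_of_lt_one h0 h1).mul_left 2
  have htend : ∀ z ∈ Metric.ball (0 : ℂ) 1,
      Tendsto (fun k => schurApprox β k n z) atTop (𝓝 (∑' k, F k z)) := by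
    intro z hz
    have hs : Summable fun k => F k z :=
      Summable.of_norm_bounded (hsum ‖z‖ (norm_nonneg z) (by simpa using hz))
        fun k => norm_schurApprox_succ_sub_le hβ k n z hz
    have := hs.hasSum.tendsto_sum_nat
    simp only [hF, Finset.sum_range_sub (fun k => schurApprox β k n z)] at this
    exact this.congr fun k => sub_zero _
  refine ⟨fun z => ∑' k, F k z, ⟨fun z hz => ?_, fun z hz => ?_⟩, htend⟩
  · obtain ⟨r, hr, hr1⟩ := exists_between (show ‖z‖ < 1 by simpa using hz)
    have hsub : Metric.ball (0 : ℂ) r ⊆ Metric.ball 0 1 := Metric.ball_subset_ball hr1.le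
    have h := Complex.differentiableOn_tsum_of_summable_norm
      (hsum r ((norm_nonneg z).trans hr.le) hr1) (F := F) (U := Metric.ball 0 r)
      (fun k => ((isSchur_schurApprox hβ (k + 1) n).1.sub
        (isSchur_schurApprox hβ k n).1).mono hsub) Metric.isOpen_ball
      (fun k w hw => (norm_schurApprox_succ_sub_le hβ k n w (hsub hw)).trans (by
        have : ‖w‖ ≤ r := by simpa using (mem_ball_zero_iff.1 hw).le
        gcongr))
    exact (h.differentiableAt (Metric.isOpen_ball.mem_nhds (by simpa using hr))).differentiableWithinAt
  · exact le_of_tendsto (htend z hz).norm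
      (Eventually.of_forall fun k => (isSchur_schurApprox hβ k n).2 z hz)

theorem exists_isSchurFunctionOf {β : ℕ → ℂ} (hβ : ∀ n, ‖β n‖ < 1) :
    ∃ f : ℂ → ℂ, IsSchurFunctionOf β f := by
  choose s hs ht using exists_isSchur_tendsto_schurApprox hβ
  refine ⟨s 0, s, rfl, hs, fun n z hz => ?_⟩
  refine tendsto_nhds_unique ((tendsto_add_atTop_iff_nat 1).2 (ht n z hz)) ?_
  have h := ht (n + 1) z hz
  exact (tendsto_const_nhds.add (tendsto_const_nhds.mul h)).div
    (tendsto_const_nhds.add (tendsto_const_nhds.mul h)) (schurStep_denom_ne_zero (hβ n) (hs _) hz)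

/-! ### Fatou's theorem: nontangential limits of bounded analytic functions -/

theorem sq_norm_one_add_eq_of_norm_eq_one {w : ℂ} (hw : ‖w‖ = 1) :
    ‖1 + w‖ ^ 2 = 4 - ‖w - 1‖ ^ 2 := by
  have h : ‖w‖ ^ 2 = 1 := by rw [hw]; norm_num
  simp only [Complex.sq_norm, Complex.normSq_apply, Complex.add_re, Complex.add_im, Complex.sub_re,
    Complex.sub_im, Complex.one_re, Complex.one_im] at h ⊢
  linarith

/-- Maximum principle for bounded functions with one exceptional boundary point. -/
theorem norm_le_of_norm_le_on_circle_sdiff_one {p : ℂ → ℂ} {K ε : ℝ} (hε : 0 < ε)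
    (hd : DifferentiableOn ℂ p (Metric.ball 0 1))
    (hc : ContinuousOn p (Metric.closedBall 0 1 \ {1}))
    (hK : ∀ z ∈ Metric.closedBall (0 : ℂ) 1, ‖p z‖ ≤ K)
    (hb : ∀ z : ℂ, ‖z‖ = 1 → z ≠ 1 → ‖p z‖ ≤ ε) {z : ℂ} (hz : z ∈ Metric.ball (0 : ℂ) 1) :
    ‖p z‖ ≤ ε := by
  have hz1 : ‖z‖ < 1 := by simpa using hz
  have hne : ∀ w : ℂ, ‖w‖ < 1 → w ≠ 1 := by
    rintro w hw rfl
    simp at hw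
  -- The factor `1 - w` removes the exceptional point, and its cost disappears on taking `n`-th
  -- roots as `n → ∞`.
  have key : ∀ n : ℕ, ‖p z‖ ^ n * ‖1 - z‖ ≤ ε ^ n * 2 := by
    intro n
    have hdc : DiffContOnCl ℂ (fun w => p w ^ n * (1 - w)) (Metric.ball 0 1) := by
      refine ⟨by fun_prop, ?_⟩
      rw [closure_ball (0 : ℂ) one_ne_zero]
      intro w hw
      rcases eq_or_ne w 1 with rfl | hw1
      · have h0 : Tendsto (fun w : ℂ => K ^ n * ‖1 - w‖) (𝓝[Metric.closedBall 0 1] 1) (𝓝 0) := by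
          have : Tendsto (fun w : ℂ => K ^ n * ‖1 - w‖) (𝓝 1) (𝓝 (K ^ n * ‖(1 : ℂ) - 1‖)) := by
            apply Continuous.tendsto
            fun_prop
          rw [sub_self, norm_zero, mul_zero] at this
          exact this.mono_left nhdsWithin_le_nhds
        rw [ContinuousWithinAt, sub_self, mul_zero]
        refine squeeze_zero_norm' ?_ h0
        filter_upwards [self_mem_nhdsWithin] with u hu
        rw [norm_mul, norm_pow]
        gcongr
        exact hK u hu
      · have h1 : ContinuousWithinAt p (Metric.closedBall 0 1) w := by
          refine (hc w ⟨hw, hw1⟩).mono_of_mem_nhdsWithin ?_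
          rw [Set.sdiff_eq]
          exact inter_mem self_mem_nhdsWithin
            (mem_nhdsWithin_of_mem_nhds (isOpen_compl_singleton.mem_nhds hw1))
        fun_prop
    have := Complex.norm_le_of_forall_mem_frontier_norm_le Metric.isBounded_ball hdc
      (C := ε ^ n * 2) (fun w hw => ?_) (subset_closure hz)
    · simpa using this
    · rw [frontier_ball (0 : ℂ) one_ne_zero, mem_sphere_zero_iff_norm] at hw
      rcases eq_or_ne w 1 with rfl | hw1
      · simp only [sub_self, mul_zero, norm_zero]
        positivity
      · rw [norm_mul, norm_pow]
        have h2 : ‖1 - w‖ ≤ 2 := by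
          refine (norm_sub_le _ _).trans ?_
          rw [hw, norm_one]
          norm_num
        gcongr
        exact hb w hw hw1
  by_contra! hcon
  have h1 : 1 < ‖p z‖ / ε := by rwa [one_lt_div hε]
  have hz0 : 0 < ‖1 - z‖ := norm_pos_iff.2 (sub_ne_zero.2 (hne z hz1).symm)
  obtain ⟨n, hn⟩ := ((tendsto_pow_atTop_atTop_of_one_lt h1).eventually_gt_atTop (2 / ‖1 - z‖)).exists
  rw [div_pow, div_lt_div_iff₀ hz0 (by positivity)] at hn
  linarith [key n]

/-- A bounded analytic function whose boundary values tend to `0` at `1` tends to `0` at `1`. -/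
theorem tendsto_zero_of_tendsto_zero_on_circle {q : ℂ → ℂ} {K : ℝ}
    (hd : DifferentiableOn ℂ q (Metric.ball 0 1))
    (hc : ContinuousOn q (Metric.closedBall 0 1 \ {1}))
    (hK : ∀ z ∈ Metric.closedBall (0 : ℂ) 1, ‖q z‖ ≤ K)
    (hb : Tendsto q (𝓝[Metric.sphere 0 1] 1) (𝓝 0)) :
    Tendsto q (𝓝[Metric.ball 0 1] 1) (𝓝 0) := by
  have hK0 : 0 ≤ K := (norm_nonneg _).trans (hK 0 (by simp))
  rw [Metric.tendsto_nhds]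
  intro ε hε
  obtain ⟨δ, hδ, hδq⟩ := (Metric.tendsto_nhdsWithin_nhds.1 hb) (ε / 2) (by positivity)
  have hnear : ∀ w : ℂ, ‖w‖ = 1 → ‖w - 1‖ < min δ 1 → ‖q w‖ ≤ ε / 2 := fun w hw hwδ => by
    have := hδq (by simpa using hw)
      (by rw [dist_eq_norm]; exact hwδ.trans_le (min_le_left _ _))
    rw [dist_zero_right] at this
    exact this.le
  set δ' := min δ 1
  have hδ' : 0 < δ' := lt_min hδ one_pos
  have hδ1 : δ' ≤ 1 := min_le_right _ _
  -- `s` bounds the peak function `(1 + w) / 2` on the part of the circle at distance at least `δ'`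
  -- from `1`; a high power of it makes `q` small there and leaves the behaviour at `1` unchanged.
  set s : ℝ := √(4 - δ' ^ 2) / 2 with hs
  have hs1 : s < 1 := by
    rw [hs, div_lt_one two_pos, Real.sqrt_lt' two_pos]
    nlinarith
  have hs0 : 0 ≤ s := by positivity
  obtain ⟨k, hk⟩ : ∃ k : ℕ, K * s ^ k ≤ ε / 2 := by
    have : Tendsto (fun k : ℕ => K * s ^ k) atTop (𝓝 (K * 0)) :=
      (tendsto_pow_atTop_nhds_zero_of_lt_one hs0 hs1).const_mul K
    rw [mul_zero] at this
    exact (this.eventually (Iic_mem_nhds (by positivity))).exists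
  have hpeak : ∀ w : ℂ, ‖w‖ ≤ 1 → ‖(1 + w) / 2‖ ≤ 1 := fun w hw => by
    rw [norm_div, div_le_one (by simp)]
    refine (norm_add_le _ _).trans ?_
    rw [norm_one, RCLike.norm_ofNat]
    linarith
  have hmain : ∀ z ∈ Metric.ball (0 : ℂ) 1, ‖q z * ((1 + z) / 2) ^ k‖ ≤ ε / 2 := by
    intro z hz
    refine norm_le_of_norm_le_on_circle_sdiff_one (p := fun z => q z * ((1 + z) / 2) ^ k) (K := K)
      (by positivity) (by fun_prop) (by fun_prop) (fun w hw => ?_) (fun w hw hw1 => ?_) hz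
    · rw [norm_mul, norm_pow]
      refine (mul_le_mul_of_nonneg_left
        (pow_le_one₀ (norm_nonneg _) (hpeak w (by simpa using hw))) (norm_nonneg _)).trans ?_
      rw [mul_one]
      exact hK w hw
    · rw [norm_mul, norm_pow]
      rcases lt_or_ge ‖w - 1‖ δ' with h | h
      · refine (mul_le_mul_of_nonneg_left
          (pow_le_one₀ (norm_nonneg _) (hpeak w hw.le)) (norm_nonneg _)).trans ?_
        rw [mul_one]
        exact hnear w hw h
      · refine le_trans ?_ hk
        have : ‖(1 + w) / 2‖ ≤ s := by
          rw [hs, norm_div, RCLike.norm_ofNat]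
          gcongr
          refine Real.le_sqrt_of_sq_le ?_
          rw [sq_norm_one_add_eq_of_norm_eq_one hw]
          gcongr
        gcongr
        exact hK w (by simp [hw])
  have hlim : Tendsto (fun z : ℂ => ‖((1 + z) / 2) ^ k‖) (𝓝[Metric.ball 0 1] 1) (𝓝 1) := by
    have : Tendsto (fun z : ℂ => ‖((1 + z) / 2) ^ k‖) (𝓝 1) (𝓝 ‖(((1 : ℂ) + 1) / 2) ^ k‖) := by
      apply Continuous.tendsto
      fun_prop
    norm_num at this
    refine (this.mono_left nhdsWithin_le_nhds).congr fun z => ?_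
    simp
  filter_upwards [hlim.eventually (lt_mem_nhds (show (1 / 2 : ℝ) < 1 by norm_num)),
    self_mem_nhdsWithin] with z hz hzb
  rw [dist_zero_right]
  have := hmain z hzb
  rw [norm_mul] at this
  by_contra! hcon
  nlinarith [norm_nonneg (q z)]

/-- If `R` is analytic in the disk, `O(z - 1)` on the closed disk and `o(z - 1)` on the circle, then
`R'` has nontangential limit `0` at `1`. -/
theorem tendsto_deriv_stolzSet {R : ℂ → ℂ} {K : ℝ}
    (hd : DifferentiableOn ℂ R (Metric.ball 0 1)) (hc : Continuous R)
    (hK : ∀ z, ‖R z‖ ≤ K * ‖z - 1‖)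
    (hb : R =o[𝓝[Metric.sphere 0 1] 1] (fun z => z - 1)) (M : ℝ) :
    Tendsto (deriv R) (𝓝[Complex.stolzSet M] 1) (𝓝 0) := by
  have hK0 : 0 ≤ K := by
    have := (norm_nonneg _).trans (hK 0)
    simpa using this
  have hne : ∀ w : ℂ, ‖w‖ < 1 → w - 1 ≠ 0 := by
    intro w hw h
    rw [sub_eq_zero.1 h] at hw
    simp at hw
  have hq : Tendsto (fun z => R z / (z - 1)) (𝓝[Metric.ball 0 1] 1) (𝓝 0) := by
    refine tendsto_zero_of_tendsto_zero_on_circle (K := K) ?_ ?_ (fun z _ => ?_)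
      hb.tendsto_div_nhds_zero
    · exact hd.div (by fun_prop) fun z hz => hne z (by simpa using hz)
    · exact hc.continuousOn.div (by fun_prop) fun z hz => sub_ne_zero.2 hz.2
    · rw [norm_div]
      exact div_le_of_le_mul₀ (norm_nonneg _) hK0 (hK z)
  rcases le_or_gt M 1 with hM | hM
  · simp [Complex.stolzSet_empty hM]
  rw [Metric.tendsto_nhdsWithin_nhds]
  intro ε hε
  obtain ⟨δ, hδ, hδq⟩ := (Metric.tendsto_nhdsWithin_nhds.1 hq) (ε / (8 * M)) (by positivity)
  refine ⟨δ / 2, by positivity, fun z hz hzδ => ?_⟩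
  obtain ⟨hz1, hzM⟩ := hz
  rw [dist_eq_norm] at hzδ
  -- Cauchy's estimate on this circle: `R` is at most `ε / (8M) * 2‖z - 1‖` there, and the Stolz
  -- condition makes `‖z - 1‖` comparable to `ρ`, leaving `ε / 2`.
  set ρ : ℝ := (1 - ‖z‖) / 2 with hρ
  have hρ0 : 0 < ρ := by rw [hρ]; linarith
  have hρz : ρ ≤ ‖z - 1‖ := by
    have := norm_sub_norm_le (1 : ℂ) z
    rw [norm_one, norm_sub_rev] at this
    rw [hρ]
    linarith
  have hsub : ∀ u ∈ Metric.closedBall z ρ, ‖u‖ < 1 ∧ ‖u - 1‖ ≤ 2 * ‖z - 1‖ := by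
    intro u hu
    rw [mem_closedBall_iff_norm] at hu
    have h1 := norm_add_le (u - z) z
    have h2 := norm_add_le (u - z) (z - 1)
    rw [sub_add_cancel] at h1
    rw [sub_add_sub_cancel] at h2
    constructor <;> linarith
  rw [dist_zero_right]
  have hcauchy : ‖deriv R z‖ ≤ (ε / (8 * M) * (2 * (M * (1 - ‖z‖)))) / ρ := by
    refine Complex.norm_deriv_le_of_forall_mem_sphere_norm_le hρ0 ?_ fun u hu => ?_
    · exact ⟨hd.mono fun u hu => by
        simpa using (hsub u (Metric.ball_subset_closedBall hu)).1, hc.continuousOn⟩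
    · obtain ⟨hu1, hu2⟩ := hsub u (Metric.sphere_subset_closedBall hu)
      have h3 := hδq (x := u) (by simpa using hu1) (by rw [dist_eq_norm]; linarith)
      rw [dist_zero_right, norm_div, div_lt_iff₀ (norm_pos_iff.2 (hne u hu1))] at h3
      refine h3.le.trans ?_
      gcongr
      refine hu2.trans ?_
      rw [norm_sub_rev]
      gcongr
  refine hcauchy.trans_lt ?_
  have hz0 : 0 < 1 - ‖z‖ := by linarith
  have : (ε / (8 * M) * (2 * (M * (1 - ‖z‖)))) / ρ = ε / 2 := by
    rw [hρ]
    field_simp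
    norm_num
  rw [this]
  linarith

/-- Chordal and angular derivatives on the unit circle agree. -/
theorem isLittleO_sub_one_of_hasDerivAt_circle {G : ℂ → ℂ} {d : ℂ}
    (h : HasDerivAt (fun t : ℝ => G (Complex.exp (t * Complex.I))) d 0) :
    (fun z => G z - G 1 - d / Complex.I * (z - 1)) =o[𝓝[Metric.sphere 0 1] 1]
      (fun z => z - 1) := by
  have hexp : HasDerivAt (fun t : ℝ => Complex.exp (t * Complex.I)) Complex.I 0 := by
    have h1 : HasDerivAt (fun t : ℝ => (t : ℂ) * Complex.I) (1 * Complex.I) 0 :=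
      (Complex.ofRealCLM.hasDerivAt (x := (0 : ℝ))).mul_const Complex.I
    simpa using h1.cexp
  -- The coefficient `d / I` makes the two derivatives in `t` cancel; substituting `t = arg z` then
  -- replaces `o(t)` by `o(z - 1)`.
  have h2 := (h.sub (hexp.const_mul (d / Complex.I)))
  rw [div_mul_cancel₀ d Complex.I_ne_zero, sub_self, hasDerivAt_iff_isLittleO_nhds_zero] at h2
  simp only [zero_add, Complex.ofReal_zero, zero_mul, Complex.exp_zero, smul_zero, sub_zero,
    Pi.sub_apply, mul_one] at h2
  have harg : Tendsto Complex.arg (𝓝[Metric.sphere 0 1] 1) (𝓝 0) := by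
    have := (Complex.continuousAt_arg (x := 1) (by simp)).tendsto
    rw [Complex.arg_one] at this
    exact this.mono_left nhdsWithin_le_nhds
  have h3 := h2.comp_tendsto harg
  have hlog : (fun z : ℂ => Complex.log z) =O[𝓝[Metric.sphere 0 1] 1] (fun z => z - 1) := by
    have := (Complex.hasDerivAt_log (z := 1) (by simp)).differentiableAt.isBigO_sub
    simp only [Complex.log_one, sub_zero] at this
    exact this.mono nhdsWithin_le_nhds
  have harg2 : (fun z : ℂ => Complex.arg z) =O[𝓝[Metric.sphere 0 1] 1] (fun z => z - 1) := by
    refine (Asymptotics.IsBigO.of_bound 1 (Eventually.of_forall fun z => ?_)).trans hlog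
    rw [one_mul, ← Complex.log_im, Real.norm_eq_abs]
    exact Complex.abs_im_le_norm _
  refine (h3.trans_isBigO harg2).congr' ?_ EventuallyEq.rfl
  filter_upwards [self_mem_nhdsWithin] with z hz
  have hz' : Complex.exp (Complex.arg z * Complex.I) = z := by
    have := Complex.norm_mul_exp_arg_mul_I z
    rwa [mem_sphere_zero_iff_norm.1 hz, Complex.ofReal_one, one_mul] at this
  simp only [Function.comp_apply, hz']
  ring

/-- **Fatou's theorem**: a bounded analytic function in the unit disk has a nontangential limit at
almost every point of the unit circle. -/
theorem IsBoundedAnalytic.ae_exists_hasNontangentialLimit {f : ℂ → ℂ} (hf : IsBoundedAnalytic f) :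
    ∀ᵐ θ : ℝ, ∃ w : ℂ, HasNontangentialLimit f (Complex.exp ((θ : ℂ) * Complex.I)) w := by
  obtain ⟨hd, C, hC⟩ := hf
  obtain ⟨G₀, hG₀⟩ := hd.isExactOn_ball
  have hLip : LipschitzOnWith C.toNNReal G₀ (Metric.ball 0 1) := by
    refine (convex_ball (0 : ℂ) 1).lipschitzOnWith_of_nnnorm_deriv_le
      (fun z hz => (hG₀ z hz).differentiableAt) fun z hz => ?_
    rw [(hG₀ z hz).deriv, ← norm_toNNReal]
    exact Real.toNNReal_le_toNNReal (hC z hz)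
  -- The extension gives the primitive values on the circle, where Rademacher's theorem in one
  -- variable applies.
  obtain ⟨G, hGL, hGe⟩ := hLip.extend_finite_dimension
  set L := lipschitzExtensionConstant ℂ * C.toNNReal
  have hG : ∀ z ∈ Metric.ball (0 : ℂ) 1, HasDerivAt G (f z) z := fun z hz =>
    (hG₀ z hz).congr_of_eventuallyEq
      (eventually_of_mem (Metric.isOpen_ball.mem_nhds hz) fun w hw => (hGe hw).symm)
  have hLexp : LipschitzWith 1 fun t : ℝ => Complex.exp (t * Complex.I) := by
    refine lipschitzWith_of_nnnorm_deriv_le (𝕜 := ℝ) (fun t => ?_) fun t => ?_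
    · fun_prop
    · have h1 : HasDerivAt (fun t : ℝ => (t : ℂ) * Complex.I) (1 * Complex.I) t :=
        (Complex.ofRealCLM.hasDerivAt (x := t)).mul_const Complex.I
      rw [h1.cexp.deriv, nnnorm_mul, one_mul, Complex.nnnorm_I, mul_one, ← NNReal.coe_le_coe,
        coe_nnnorm, Complex.norm_exp_ofReal_mul_I, NNReal.coe_one]
  filter_upwards [(hGL.comp hLexp).ae_differentiableAt_real] with θ hθ
  set ζ : ℂ := Complex.exp ((θ : ℂ) * Complex.I) with hζ
  have hζ1 : ‖ζ‖ = 1 := Complex.norm_exp_ofReal_mul_I θ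
  have hζ0 : ζ ≠ 0 := Complex.exp_ne_zero _
  obtain ⟨d, hdθ⟩ : ∃ d, HasDerivAt (fun t : ℝ => G (ζ * Complex.exp (t * Complex.I))) d 0 := by
    have hθ0 := hθ.hasDerivAt
    rw [← add_zero θ] at hθ0
    refine ⟨_, (hθ0.comp_const_add θ 0).congr_of_eventuallyEq (Eventually.of_forall fun t => ?_)⟩
    simp only [Function.comp_apply, hζ, Complex.ofReal_add, add_mul, Complex.exp_add]
  have hlo := isLittleO_sub_one_of_hasDerivAt_circle (G := fun z => G (ζ * z)) hdθ
  set c := d / Complex.I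
  have hball : ∀ z ∈ Metric.ball (0 : ℂ) 1, ζ * z ∈ Metric.ball (0 : ℂ) 1 := fun z hz => by
    simpa [hζ1] using hz
  have hR : ∀ z ∈ Metric.ball (0 : ℂ) 1,
      HasDerivAt (fun z => G (ζ * z) - G (ζ * 1) - c * (z - 1)) (f (ζ * z) * ζ - c) z := by
    intro z hz
    have h1 : HasDerivAt (fun z : ℂ => ζ * z) ζ z := by
      simpa using (hasDerivAt_id z).const_mul ζ
    have h2 := (hG _ (hball z hz)).comp z h1
    have h3 : HasDerivAt (fun z : ℂ => c * (z - 1)) c z := by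
      simpa using ((hasDerivAt_id z).sub_const 1).const_mul c
    exact (h2.sub_const _).sub h3
  -- The remainder `R` has derivative `f (ζ z) ζ - c`, which tends to `0` in Stolz regions.
  refine ⟨c / ζ, fun M => ?_⟩
  have hlim := tendsto_deriv_stolzSet (K := L + ‖c‖)
    (fun z hz => (hR z hz).differentiableAt.differentiableWithinAt)
    (by have := hGL.continuous; fun_prop) (fun z => ?_) hlo M
  · have h4 : Tendsto (fun z => f (ζ * z) * ζ - c) (𝓝[Complex.stolzSet M] 1) (𝓝 0) := by
      refine hlim.congr' ?_
      filter_upwards [self_mem_nhdsWithin] with z hz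
      exact (hR z (by simpa using hz.1)).deriv
    have h5 := (h4.add_const c).div_const ζ
    simpa [hζ0] using h5
  · refine (norm_sub_le _ _).trans ?_
    rw [norm_mul, add_mul]
    gcongr
    have := hGL.dist_le_mul (ζ * z) (ζ * 1)
    rwa [dist_eq_norm, dist_eq_norm, ← mul_sub, norm_mul, hζ1, one_mul] at this

/-! ### Boundary uniqueness for bounded analytic functions -/

/-- **Jensen's inequality** for analytic functions. -/
theorem log_norm_le_circleAverage {f : ℂ → ℂ} {r : ℝ} (hr : 0 < r)
    (hf : AnalyticOnNhd ℂ f (Metric.closedBall 0 r)) (h0 : f 0 ≠ 0) :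
    Real.log ‖f 0‖ ≤ Real.circleAverage (fun z => Real.log ‖f z‖) 0 r := by
  rw [← abs_of_pos hr] at hf
  rw [hf.circleAverage_log_norm hr.ne' h0]
  -- In Jensen's formula each zero `u` contributes its multiplicity times `log (r / ‖u‖) ≥ 0`.
  refine le_add_of_nonneg_left (finsum_nonneg fun u => ?_)
  by_cases hu : u ∈ Metric.closedBall (0 : ℂ) |r|
  · refine mul_nonneg (mod_cast MeromorphicOn.AnalyticOnNhd.divisor_nonneg hf u) ?_
    rw [zero_sub, norm_neg]
    rcases eq_or_ne u 0 with rfl | hu0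
    · simp
    · refine Real.log_nonneg ?_
      rw [← div_eq_mul_inv, one_le_div (norm_pos_iff.2 hu0)]
      simpa [abs_of_pos hr] using hu
  · rw [Function.locallyFinsuppWithin.apply_eq_zero_of_notMem _ hu]
    simp

/-- Zeros are isolated. They must be excluded because `Real.log 0 = 0` hides the singularity of `log
‖f‖`. -/
theorem ae_circleMap_ne_zero {f : ℂ → ℂ} (hf : DifferentiableOn ℂ f (Metric.ball 0 1))
    (h0 : f 0 ≠ 0) {r : ℝ} (hr0 : 0 < r) (hr1 : r < 1) :
    ∀ᵐ θ : ℝ ∂(volume.restrict (Set.Ioc (0 : ℝ) (2 * Real.pi))), f (circleMap 0 r θ) ≠ 0 := by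
  have h1 := (hf.analyticOnNhd Metric.isOpen_ball).preimage_zero_mem_codiscreteWithin h0
    (Metric.mem_ball_self one_pos)
    ((convex_ball (0 : ℂ) 1).isConnected (Metric.nonempty_ball.2 one_pos))
  have h2 : Metric.sphere (0 : ℂ) |r| ⊆ Metric.ball 0 1 := by
    rw [abs_of_pos hr0]
    exact Metric.sphere_subset_closedBall.trans (Metric.closedBall_subset_ball hr1)
  have h3 := circleMap_preimage_codiscrete (c := 0) hr0.ne' (codiscreteWithin_mono h2 h1)
  exact ae_restrict_le_codiscreteWithin measurableSet_Ioc
    (codiscreteWithin_mono (Set.subset_univ _) h3)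

/-- Jensen's inequality, with `log K` added to make the integrand nonnegative, as Fatou's lemma
requires. `1 ≤ K` covers the zeros of `f`, where the logarithm is `0`. The bound does not depend on
`r`. -/
theorem lintegral_log_sub_log_norm_le {f : ℂ → ℂ} (hf : DifferentiableOn ℂ f (Metric.ball 0 1))
    (h0 : f 0 ≠ 0) {K : ℝ} (hK1 : 1 ≤ K) (hK : ∀ z ∈ Metric.ball (0 : ℂ) 1, ‖f z‖ ≤ K) {r : ℝ}
    (hr0 : 0 < r) (hr1 : r < 1) :
    ∫⁻ θ in Set.Ioc (0 : ℝ) (2 * Real.pi),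
        ENNReal.ofReal (Real.log K - Real.log ‖f (circleMap 0 r θ)‖) ≤
      ENNReal.ofReal (2 * Real.pi * (Real.log K - Real.log ‖f 0‖)) := by
  have hsub : Metric.closedBall (0 : ℂ) r ⊆ Metric.ball 0 1 := Metric.closedBall_subset_ball hr1
  have han : AnalyticOnNhd ℂ f (Metric.closedBall 0 r) :=
    (hf.analyticOnNhd Metric.isOpen_ball).mono hsub
  have hcirc : ∀ θ, circleMap 0 r θ ∈ Metric.ball (0 : ℂ) 1 := fun θ =>
    hsub (circleMap_mem_closedBall 0 hr0.le θ)
  have hint : CircleIntegrable (fun z => Real.log ‖f z‖) 0 r := by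
    refine MeromorphicOn.circleIntegrable_log_norm ?_
    rw [abs_of_pos hr0]
    exact (han.mono Metric.sphere_subset_closedBall).meromorphicOn
  have hpi : (0 : ℝ) ≤ 2 * Real.pi := by positivity
  have hint' : IntervalIntegrable (fun θ => Real.log K - Real.log ‖f (circleMap 0 r θ)‖) volume 0
      (2 * Real.pi) := intervalIntegrable_const.sub hint
  rw [← ofReal_integral_eq_lintegral_ofReal
    ((intervalIntegrable_iff_integrableOn_Ioc_of_le hpi).1 hint')
    (Eventually.of_forall fun θ => ?_), ← intervalIntegral.integral_of_le hpi]
  · refine ENNReal.ofReal_le_ofReal ?_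
    have h := log_norm_le_circleAverage hr0 han h0
    rw [Real.circleAverage_def, smul_eq_mul, inv_mul_eq_div, le_div_iff₀ (by positivity)] at h
    rw [intervalIntegral.integral_sub intervalIntegrable_const hint,
      intervalIntegral.integral_const, smul_eq_mul, sub_zero]
    linarith
  · rw [Pi.zero_apply, sub_nonneg]
    rcases eq_or_ne (f (circleMap 0 r θ)) 0 with h | h
    · rw [h, norm_zero, Real.log_zero]
      exact Real.log_nonneg hK1
    · exact Real.log_le_log (norm_pos_iff.2 h) (hK _ (hcirc θ))

/-- The radial limits of a bounded analytic function that does not vanish at the centre are nonzero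
almost everywhere. -/
theorem IsBoundedAnalytic.ae_not_tendsto_zero {f : ℂ → ℂ} (hf : IsBoundedAnalytic f)
    (h0 : f 0 ≠ 0) {r : ℕ → ℝ} (hr0 : ∀ n, 0 < r n) (hr1 : ∀ n, r n < 1) :
    ∀ᵐ θ : ℝ ∂(volume.restrict (Set.Ioc (0 : ℝ) (2 * Real.pi))),
      ¬ Tendsto (fun n => f (circleMap 0 (r n) θ)) atTop (𝓝 0) := by
  obtain ⟨hd, C, hC⟩ := hf
  set K := max C 1
  have hK : ∀ z ∈ Metric.ball (0 : ℂ) 1, ‖f z‖ ≤ K := fun z hz => (hC z hz).trans (le_max_left _ _)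
  set u : ℕ → ℝ → ENNReal := fun n θ =>
    ENNReal.ofReal (Real.log K - Real.log ‖f (circleMap 0 (r n) θ)‖) with hu
  have hmeas : ∀ n, Measurable (u n) := by
    intro n
    have h1 : Continuous fun θ => f (circleMap 0 (r n) θ) :=
      hd.continuousOn.comp_continuous (continuous_circleMap 0 (r n)) fun θ => by
        simpa [abs_of_pos (hr0 n)] using hr1 n
    exact ((Real.measurable_log.comp h1.norm.measurable).const_sub _).ennreal_ofReal
  -- Fatou's lemma makes the lower limit integrable, hence finite almost everywhere; a radial limit
  -- `0` would make it infinite.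
  have hfin : ∫⁻ θ in Set.Ioc (0 : ℝ) (2 * Real.pi), liminf (fun n => u n θ) atTop ≠ ⊤ := by
    refine ne_top_of_le_ne_top (b := ENNReal.ofReal
      (2 * Real.pi * (Real.log K - Real.log ‖f 0‖))) ENNReal.ofReal_ne_top
      ((lintegral_liminf_le hmeas).trans (liminf_le_of_le (by isBoundedDefault) fun b hb => ?_))
    obtain ⟨n, hn⟩ := hb.exists
    exact hn.trans (lintegral_log_sub_log_norm_le hd h0 (le_max_right _ _) hK (hr0 n) (hr1 n))
  filter_upwards [ae_lt_top (Measurable.liminf hmeas) hfin,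
    ae_all_iff.2 fun n => ae_circleMap_ne_zero hd h0 (hr0 n) (hr1 n)] with θ hθ hne hlim
  have h1 : Tendsto (fun n => ‖f (circleMap 0 (r n) θ)‖) atTop (𝓝[≠] 0) := by
    refine tendsto_nhdsWithin_iff.2 ⟨?_, Eventually.of_forall fun n => norm_ne_zero_iff.2 (hne n)⟩
    simpa using hlim.norm
  have h2 : Tendsto (fun n => Real.log K - Real.log ‖f (circleMap 0 (r n) θ)‖) atTop atTop := by
    simp only [sub_eq_add_neg]
    exact tendsto_atTop_add_const_left _ _
      (tendsto_neg_atBot_atTop.comp (Real.tendsto_log_nhdsNE_zero.comp h1))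
  have h3 : Tendsto (fun n => u n θ) atTop (𝓝 ⊤) := ENNReal.tendsto_ofReal_atTop.comp h2
  rw [h3.liminf_eq] at hθ
  exact lt_irrefl _ hθ

/-! ### Wall polynomials on the unit circle -/

theorem natDegree_revPoly_le {n : ℕ} {p : ℂ[X]} (hp : p.natDegree ≤ n) :
    (revPoly n p).natDegree ≤ n :=
  natDegree_reflect_le.trans (max_le le_rfl ((natDegree_map_le).trans hp))

/-- On the circle `1 / conj ζ = ζ`, so reversal becomes conjugation up to a unimodular factor. -/
theorem eval_revPoly_of_norm_eq_one {n : ℕ} {p : ℂ[X]} (hp : p.natDegree ≤ n) {ζ : ℂ}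
    (hζ : ‖ζ‖ = 1) : (revPoly n p).eval ζ = ζ ^ n * (starRingEnd ℂ) (p.eval ζ) := by
  have hζ0 : ζ ≠ 0 := by
    rintro rfl
    simp at hζ
  have hinv : (starRingEnd ℂ) ζ = ζ⁻¹ := by
    rw [Complex.inv_def, Complex.normSq_eq_norm_sq, hζ]
    simp
  let _ : Invertible ((starRingEnd ℂ) ζ) :=
    ⟨ζ, by rw [hinv, mul_inv_cancel₀ hζ0], by rw [hinv, inv_mul_cancel₀ hζ0]⟩
  have h := eval₂_reflect_mul_pow (RingHom.id ℂ) ((starRingEnd ℂ) ζ) n (p.map (starRingEnd ℂ))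
    ((natDegree_map_le).trans hp)
  have h1 : (p.map (starRingEnd ℂ)).eval ((starRingEnd ℂ) ζ) = (starRingEnd ℂ) (p.eval ζ) := by
    rw [eval_map, eval₂_at_apply]
  change eval ζ (revPoly n p) * ((starRingEnd ℂ) ζ) ^ n = eval _ _ at h
  rw [h1, hinv, inv_pow] at h
  rw [← h]
  field_simp

theorem natDegree_wall_le (α : ℕ → ℂ) (n : ℕ) :
    (wallA α n).natDegree ≤ n ∧ (wallB α n).natDegree ≤ n := by
  induction n with
  | zero => simp [wallA, wallB, wall]
  | succ n ih =>
    have key : ∀ p q : ℂ[X], p.natDegree ≤ n → q.natDegree ≤ n →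
        (p + C (α (n + 1)) * X * revPoly n q).natDegree ≤ n + 1 := by
      intro p q hp hq
      refine natDegree_add_le_of_degree_le (hp.trans n.le_succ) ?_
      refine natDegree_mul_le.trans ?_
      have h1 : (C (α (n + 1)) * X).natDegree ≤ 1 := by
        simpa using natDegree_C_mul_X_pow_le (α (n + 1)) 1
      have h2 := natDegree_revPoly_le hq
      omega
    exact ⟨key _ _ ih.1 ih.2, key _ _ ih.2 ih.1⟩

theorem eval_zero_wallB (α : ℕ → ℂ) (n : ℕ) : (wallB α n).eval 0 = 1 := by
  induction n with
  | zero => simp [wallB, wall]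
  | succ n ih =>
    change eval 0 (wallB α n + C (α (n + 1)) * X * revPoly n (wallA α n)) = 1
    simp [ih]

theorem sq_norm_add_conj_mul_sub (a b c : ℂ) :
    ‖b + (starRingEnd ℂ) a * c‖ ^ 2 - ‖a + (starRingEnd ℂ) b * c‖ ^ 2 =
      (‖b‖ ^ 2 - ‖a‖ ^ 2) * (1 - ‖c‖ ^ 2) := by
  simp only [Complex.sq_norm, Complex.normSq_apply, Complex.add_re, Complex.add_im, Complex.mul_re,
    Complex.mul_im, Complex.conj_re, Complex.conj_im]
  ring

theorem sq_norm_add_revPoly_mul_sub {n : ℕ} {p q : ℂ[X]} (hp : p.natDegree ≤ n)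
    (hq : q.natDegree ≤ n) {ζ : ℂ} (hζ : ‖ζ‖ = 1) (w : ℂ) :
    ‖q.eval ζ + ζ * (revPoly n p).eval ζ * w‖ ^ 2 - ‖p.eval ζ + ζ * (revPoly n q).eval ζ * w‖ ^ 2 =
      (‖q.eval ζ‖ ^ 2 - ‖p.eval ζ‖ ^ 2) * (1 - ‖w‖ ^ 2) := by
  rw [eval_revPoly_of_norm_eq_one hp hζ, eval_revPoly_of_norm_eq_one hq hζ]
  have h := sq_norm_add_conj_mul_sub (p.eval ζ) (q.eval ζ) (ζ ^ (n + 1) * w)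
  rw [norm_mul, norm_pow, hζ, one_pow, one_mul] at h
  rw [← h]
  ring_nf

/-- The Wall recursion is the preceding identity at `w = α (n + 1)`, so each step contributes the
factor `1 - ‖α (n + 1)‖ ^ 2`. -/
theorem sq_norm_wallB_sub_sq_norm_wallA (α : ℕ → ℂ) (n : ℕ) {ζ : ℂ} (hζ : ‖ζ‖ = 1) :
    ‖(wallB α n).eval ζ‖ ^ 2 - ‖(wallA α n).eval ζ‖ ^ 2 = omega α n := by
  induction n with
  | zero => simp [wallA, wallB, wall, omega]
  | succ n ih =>
    obtain ⟨hA, hB⟩ := natDegree_wall_le α n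
    have h := sq_norm_add_revPoly_mul_sub hA hB hζ (α (n + 1))
    rw [ih] at h
    rw [omega, Finset.prod_range_succ, ← omega, ← h]
    change ‖eval ζ (wallB α n + C (α (n + 1)) * X * revPoly n (wallA α n))‖ ^ 2 -
      ‖eval ζ (wallA α n + C (α (n + 1)) * X * revPoly n (wallB α n))‖ ^ 2 = _
    simp only [eval_add, eval_mul, eval_C, eval_X]
    ring_nf

/-! ### Bounded analytic functions -/

theorem IsSchur.isBoundedAnalytic {f : ℂ → ℂ} (hf : IsSchur f) : IsBoundedAnalytic f :=
  ⟨hf.1, 1, hf.2⟩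

theorem IsBoundedAnalytic.add {f g : ℂ → ℂ} (hf : IsBoundedAnalytic f) (hg : IsBoundedAnalytic g) :
    IsBoundedAnalytic fun z => f z + g z := by
  obtain ⟨hf, C, hC⟩ := hf
  obtain ⟨hg, D, hD⟩ := hg
  exact ⟨hf.add hg, C + D, fun z hz => (norm_add_le _ _).trans (add_le_add (hC z hz) (hD z hz))⟩

theorem IsBoundedAnalytic.mul {f g : ℂ → ℂ} (hf : IsBoundedAnalytic f) (hg : IsBoundedAnalytic g) :
    IsBoundedAnalytic fun z => f z * g z := by
  obtain ⟨hf, C, hC⟩ := hf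
  obtain ⟨hg, D, hD⟩ := hg
  refine ⟨hf.mul hg, C * D, fun z hz => ?_⟩
  rw [norm_mul]
  exact mul_le_mul (hC z hz) (hD z hz) (norm_nonneg _) ((norm_nonneg _).trans (hC z hz))

theorem IsBoundedAnalytic.const (c : ℂ) : IsBoundedAnalytic fun _ => c :=
  ⟨differentiableOn_const c, ‖c‖, fun _ _ => le_rfl⟩

theorem IsBoundedAnalytic.sub {f g : ℂ → ℂ} (hf : IsBoundedAnalytic f) (hg : IsBoundedAnalytic g) :
    IsBoundedAnalytic fun z => f z - g z := by
  simpa [sub_eq_add_neg] using hf.add ((IsBoundedAnalytic.const (-1)).mul hg)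

theorem isBoundedAnalytic_eval (p : ℂ[X]) : IsBoundedAnalytic fun z => p.eval z := by
  refine ⟨p.differentiable.differentiableOn, ?_⟩
  obtain ⟨K, hK⟩ := (isCompact_closedBall (0 : ℂ) 1).exists_bound_of_continuousOn
    p.continuous.continuousOn
  exact ⟨K, fun z hz => hK z (Metric.ball_subset_closedBall hz)⟩

theorem isBoundedAnalytic_id : IsBoundedAnalytic fun z => z := by
  simpa using isBoundedAnalytic_eval X

/-! ### Nontangential limits -/

theorem neBot_nhdsWithin_stolzSet {M : ℝ} (hM : 1 < M) : (𝓝[Complex.stolzSet M] (1 : ℂ)).NeBot :=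
  Filter.NeBot.mono inferInstance (Complex.nhdsWithin_lt_le_nhdsWithin_stolzSet hM)

theorem hasNontangentialLimit_of_continuous {g : ℂ → ℂ} (hg : Continuous g) (ζ : ℂ) :
    HasNontangentialLimit g ζ (g ζ) := fun M => by
  have h : Tendsto (fun z => g (ζ * z)) (𝓝 1) (𝓝 (g (ζ * 1))) := by
    apply Continuous.tendsto
    fun_prop
  rw [mul_one] at h
  exact h.mono_left nhdsWithin_le_nhds

theorem HasNontangentialLimit.norm_le_one {f : ℂ → ℂ} (hf : IsSchur f) {ζ w : ℂ} (hζ : ‖ζ‖ = 1)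
    (h : HasNontangentialLimit f ζ w) : ‖w‖ ≤ 1 := by
  have := neBot_nhdsWithin_stolzSet (M := 2) (by norm_num)
  refine le_of_tendsto (h 2).norm ?_
  filter_upwards [self_mem_nhdsWithin] with z hz
  exact hf.2 _ (by simpa [hζ] using hz.1)

theorem HasNontangentialLimit.tendsto_circleMap {f : ℂ → ℂ} {θ : ℝ} {w : ℂ}
    (h : HasNontangentialLimit f (Complex.exp ((θ : ℂ) * Complex.I)) w) {r : ℕ → ℝ}
    (hr : Tendsto r atTop (𝓝[<] 1)) :
    Tendsto (fun n => f (circleMap 0 (r n) θ)) atTop (𝓝 w) := by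
  have h1 : Tendsto (fun n => ((r n : ℝ) : ℂ)) atTop (𝓝[Complex.stolzSet 2] 1) :=
    (tendsto_map'_iff.1 (tendsto_id.mono_left le_rfl) |>.comp hr).mono_right
      (Complex.nhdsWithin_lt_le_nhdsWithin_stolzSet (by norm_num))
  refine ((h 2).comp h1).congr fun n => ?_
  rw [Function.comp_apply, circleMap_zero, mul_comm]

/-- A bounded analytic function that does not vanish at the centre has nonzero nontangential limits
almost everywhere. -/
theorem IsBoundedAnalytic.ae_nontangentialLimit_ne_zero {f : ℂ → ℂ} (hf : IsBoundedAnalytic f)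
    (h0 : f 0 ≠ 0) :
    ∀ᵐ θ : ℝ ∂(volume.restrict (Set.Ioc (0 : ℝ) (2 * Real.pi))),
      ¬ HasNontangentialLimit f (Complex.exp ((θ : ℂ) * Complex.I)) 0 := by
  obtain ⟨r, -, hr01, hr⟩ := exists_seq_strictMono_tendsto' (zero_lt_one (α := ℝ))
  filter_upwards [hf.ae_not_tendsto_zero h0 (fun n => (hr01 n).1) fun n => (hr01 n).2] with θ hθ h
  exact hθ (h.tendsto_circleMap
    (tendsto_nhdsWithin_iff.2 ⟨hr, Eventually.of_forall fun n => (hr01 n).2⟩))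

theorem re_one_add_div_one_sub (u : ℂ) :
    ((1 + u) / (1 - u)).re = (1 - ‖u‖ ^ 2) / ‖1 - u‖ ^ 2 := by
  simp only [Complex.sq_norm, Complex.div_re, Complex.normSq_apply, Complex.add_re, Complex.add_im,
    Complex.sub_re, Complex.sub_im, Complex.one_re, Complex.one_im]
  rw [← add_div]
  ring_nf

/-! ### The main theorem -/

theorem isPseudoCaratheodory_schurCompose (α : ℕ → ℂ) (n : ℕ) {φ : ℂ → ℂ} (hφ : IsSchur φ) :
    IsPseudoCaratheodory (fun z => ((Real.sign (omega α n) : ℝ) : ℂ) *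
      caratheodoryOf (schurCompose α n φ) z) := by
  set ε : ℂ := ((Real.sign (omega α n) : ℝ) : ℂ) with hε
  set P : ℂ → ℂ := fun z => (wallA α n).eval z + z * (revPoly n (wallB α n)).eval z * φ z
  set Q : ℂ → ℂ := fun z => (wallB α n).eval z + z * (revPoly n (wallA α n)).eval z * φ z with hQ
  have hPb : IsBoundedAnalytic P := (isBoundedAnalytic_eval _).add
    ((isBoundedAnalytic_id.mul (isBoundedAnalytic_eval _)).mul hφ.isBoundedAnalytic)
  have hQb : IsBoundedAnalytic Q := (isBoundedAnalytic_eval _).add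
    ((isBoundedAnalytic_id.mul (isBoundedAnalytic_eval _)).mul hφ.isBoundedAnalytic)
  have hQ0 : Q 0 = 1 := by simp [hQ, eval_zero_wallB]
  have hDb : IsBoundedAnalytic fun z => Q z - z * P z := hQb.sub (isBoundedAnalytic_id.mul hPb)
  have hF : ∀ z, caratheodoryOf (schurCompose α n φ) z =
      (1 + z * (P z / Q z)) / (1 - z * (P z / Q z)) := fun z => rfl
  -- The common factor `Q` puts the zeros of `Q`, where `P z / Q z` takes the default value `0`,
  -- among the excluded zeros of the denominator.
  refine ⟨⟨fun z => ε * (Q z * (Q z + z * P z)), fun z => Q z * (Q z - z * P z),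
    (IsBoundedAnalytic.const ε).mul (hQb.mul (hQb.add (isBoundedAnalytic_id.mul hPb))),
    hQb.mul hDb, ⟨0, by simp, by simp [hQ0]⟩, fun z _ hz => ?_⟩, ?_⟩
  · obtain ⟨h1, h2⟩ := mul_ne_zero_iff.1 hz
    have h3 : 1 - z * (P z / Q z) = (Q z - z * P z) / Q z := by field_simp
    have h4 : 1 + z * (P z / Q z) = (Q z + z * P z) / Q z := by field_simp
    simp only [hF, h3, h4]
    rw [div_div_div_cancel_right₀ h1, mul_div_assoc, mul_div_mul_left _ _ h1]
  · filter_upwards [ae_restrict_of_ae hφ.isBoundedAnalytic.ae_exists_hasNontangentialLimit,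
      hQb.ae_nontangentialLimit_ne_zero (by simp [hQ0]),
      hDb.ae_nontangentialLimit_ne_zero (by simp [hQ0])] with θ ⟨w, hw⟩ hQθ hDθ
    set ζ : ℂ := Complex.exp ((θ : ℂ) * Complex.I)
    have hζ : ‖ζ‖ = 1 := Complex.norm_exp_ofReal_mul_I θ
    have hid : HasNontangentialLimit (fun z => z) ζ ζ :=
      hasNontangentialLimit_of_continuous continuous_id ζ
    have hpoly : ∀ p : ℂ[X], HasNontangentialLimit (fun z => p.eval z) ζ (p.eval ζ) := fun p =>
      hasNontangentialLimit_of_continuous p.continuous ζ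
    set a := (wallA α n).eval ζ + ζ * (revPoly n (wallB α n)).eval ζ * w with ha
    set b := (wallB α n).eval ζ + ζ * (revPoly n (wallA α n)).eval ζ * w with hb
    have hPl : HasNontangentialLimit P ζ a := fun M =>
      (hpoly _ M).add (((hid M).mul (hpoly _ M)).mul (hw M))
    have hQl : HasNontangentialLimit Q ζ b := fun M =>
      (hpoly _ M).add (((hid M).mul (hpoly _ M)).mul (hw M))
    have hDl : HasNontangentialLimit (fun z => Q z - z * P z) ζ (b - ζ * a) := fun M =>
      (hQl M).sub ((hid M).mul (hPl M))
    have hb0 : b ≠ 0 := fun h => hQθ (h ▸ hQl)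
    have hd0 : b - ζ * a ≠ 0 := fun h => hDθ (h ▸ hDl)
    have hu : 1 - ζ * (a / b) ≠ 0 := by
      intro h
      apply hd0
      field_simp at h
      simpa using h
    refine ⟨ε * ((1 + ζ * (a / b)) / (1 - ζ * (a / b))), fun M => ?_, ?_⟩
    · have h1 := (hid M).mul ((hPl M).div (hQl M) hb0)
      exact ((h1.const_add 1).div (h1.const_sub 1) hu).const_mul ε
    · obtain ⟨hA, hB⟩ := natDegree_wall_le α n
      have h1 := sq_norm_add_revPoly_mul_sub hA hB hζ w
      rw [sq_norm_wallB_sub_sq_norm_wallA α n hζ, ← ha, ← hb] at h1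
      have hw1 := hw.norm_le_one hφ hζ
      rw [hε, Complex.re_ofReal_mul, re_one_add_div_one_sub, norm_mul, hζ, one_mul, norm_div,
        ← mul_div_assoc]
      refine div_nonneg ?_ (sq_nonneg _)
      have hbpos : 0 < ‖b‖ := norm_pos_iff.2 hb0
      have h2 : Real.sign (omega α n) * (1 - (‖a‖ / ‖b‖) ^ 2) =
          Real.sign (omega α n) * omega α n * (1 - ‖w‖ ^ 2) / ‖b‖ ^ 2 := by
        rw [mul_assoc, ← h1]
        field_simp
      rw [h2]
      refine div_nonneg (mul_nonneg (Real.sign_mul_nonneg _) ?_) (sq_nonneg _)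
      nlinarith [norm_nonneg w]

theorem theorem1 (α : ℕ → ℂ) (N : ℕ) (hN : 1 ≤ N)
    (hne : ∀ n < N, ‖α n‖ ≠ 1) (hlt : ∀ n, N ≤ n → ‖α n‖ < 1) :
    (∃ fN : ℂ → ℂ, IsSchurFunctionOf (fun n => α (N + n)) fN) ∧
    ∀ fN : ℂ → ℂ, IsSchurFunctionOf (fun n => α (N + n)) fN →
      IsPseudoCaratheodory (fun z =>
        ((Real.sign (omega α (N - 1)) : ℝ) : ℂ) *
          caratheodoryOf (schurCompose α (N - 1) fN) z) := by
  refine ⟨exists_isSchurFunctionOf fun n => hlt _ (Nat.le_add_right N n), ?_⟩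
  rintro fN ⟨s, rfl, hs, -⟩
  exact isPseudoCaratheodory_schurCompose α (N - 1) (hs 0)
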